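/- Let $(q,k_0)\in\{(2,3),(3,2)\}$, let $k\ge k_0$ be an integer, and put $[k]_q=\frac{q^k-1}{q-1}$. An $[n,k,d]$ code over $\mathbb F_q$ is a $k$-dimensional subspace $C$ of $\mathbb F_q^n$ whose minimum nonzero weight is $d$; its dual is $C^\perp=\{x\in\mathbb F_q^n : x\cdot y=0 \text{ for all } y\in C\}$, its dual distance $d^\perp$ is the minimum nonzero weight of $C^\perp$ (with $d^\perp=\infty$ if $C^\perp=0$), and $C$ is LCD if $C\cap C^\perp=\{0\}$. Two codes $C_1,C_2$ of length $n$ are equivalent if $C_2=\{cP : c\in C_1\}$ for some $n\times n$ monomial matrix $P$ over $\mathbb F_q$. Fix $t\in\{0,1,\dots,[k]_q-1\}$ and an integer $\alpha(t)$ (depending only on $t$), and for every integer $s\ge 0$ put $n(s)=[k]_q\,s+t$ and $d(s)=q^{k-1}s+\alpha(t)$. Define $$r=q^{k-1}n(s)-[k]_q\,d(s),\qquad s'=\frac{q\,r-t}{[k]_q}+1 .$$ Then $r$ and $s'$ are integers that do not depend on $s$. Suppose that $qr\ge k$. Then $$[qr,\;k,\;(q-1)r]=\bigl[[k]_q(s'-1)+t,\;k,\;q^{k-1}(s'-1)+\alpha(t)\bigr],$$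 and the following hold. (i) For every integer $s\ge s'$ there is a one-to-one correspondence between the equivalence classes of LCD $[qr,k,(q-1)r]$ codes over $\mathbb F_q$ with $d^\perp\ge 2$ and the equivalence classes of LCD $[[k]_q\,s+t,\;k,\;q^{k-1}s+\alpha(t)]$ codes over $\mathbb F_q$ with $d^\perp\ge 2$. (ii) If there is no LCD $[qr,k,(q-1)r]$ code over $\mathbb F_q$ with $d^\perp\ge 2$, then for every integer $s\ge 0$ there is no LCD $[[k]_q\,s+t,\;k,\;q^{k-1}s+\alpha(t)]$ code over $\mathbb F_q$ (of any dual distance). -/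

import Mathlib

/-!
A linear code of length `n` over a field `F` is a subspace of `F ^ n`, that is, a term of
`Submodule F (Fin n → F)`.  The weight of a vector is its Hamming norm `hammingNorm`.
-/

namespace LCDCode

section Codes

variable {F : Type*} [Field F] {n : ℕ}

/-- The dual code with respect to the standard inner product. -/
def dualCode (C : Submodule F (Fin n → F)) : Submodule F (Fin n → F) where
  carrier := {x | ∀ y ∈ C, x ⬝ᵥ y = 0}
  zero_mem' := fun y _ => zero_dotProduct y
  add_mem' := fun {a b} ha hb y hy => by
    rw [add_dotProduct, ha y hy, hb y hy, add_zero]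
  smul_mem' := fun c x hx y hy => by
    rw [smul_dotProduct, hx y hy, smul_zero]

/-- A code is LCD if it meets its dual code trivially. -/
def IsLCD (C : Submodule F (Fin n → F)) : Prop :=
  C ⊓ dualCode C = ⊥

/-- The minimum weight of the nonzero codewords, equal to `⊤` for the zero code. -/
noncomputable def minWeight [DecidableEq F] (C : Submodule F (Fin n → F)) : ℕ∞ :=
  ⨅ (c : Fin n → F) (_ : c ∈ C) (_ : c ≠ 0), (hammingNorm c : ℕ∞)

/-- `C` is an `[n, k, d]` code.  Here `d` is an integer, since it will be given by a formula that
may take negative values; there is no `[n, k, d]` code if `d` is negative. -/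
def HasParams [DecidableEq F] (C : Submodule F (Fin n → F)) (k : ℕ) (d : ℤ) : Prop :=
  Module.finrank F C = k ∧ ∃ m : ℕ, minWeight C = m ∧ (m : ℤ) = d

/-- Monomial matrices: exactly one nonzero entry in each row and in each column. -/
def IsMonomial (P : Matrix (Fin n) (Fin n) F) : Prop :=
  (∀ i, ∃! j, P i j ≠ 0) ∧ (∀ j, ∃! i, P i j ≠ 0)

/-- Equivalence of codes: `C₂ = {c P | c ∈ C₁}` for some monomial matrix `P`. -/
def CodeEquiv (C₁ C₂ : Submodule F (Fin n → F)) : Prop :=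
  ∃ P : Matrix (Fin n) (Fin n) F, IsMonomial P ∧
    (C₂ : Set (Fin n → F)) = {x | ∃ c ∈ C₁, x = Matrix.vecMul c P}

theorem isMonomial_iff (P : Matrix (Fin n) (Fin n) F) :
    IsMonomial P ↔ ∃ (σ : Equiv.Perm (Fin n)) (u : Fin n → F), (∀ i, u i ≠ 0) ∧
      P = Matrix.of fun i j => if σ i = j then u i else 0 := by
  constructor
  · rintro ⟨h1, h2⟩
    choose f hf hf' using h1
    have hinj : Function.Injective f := by
      intro a b hab
      exact (h2 (f a)).unique (hf a) (by rw [hab]; exact hf b)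
    refine ⟨Equiv.ofBijective f (Finite.injective_iff_bijective.mp hinj),
      fun i => P i (f i), hf, ?_⟩
    ext i j
    simp only [Matrix.of_apply, Equiv.ofBijective_apply]
    split_ifs with h
    · rw [h]
    · by_contra hne
      exact h (hf' i j hne).symm
  · rintro ⟨σ, u, hu, rfl⟩
    refine ⟨fun i => ⟨σ i, by simp [hu], ?_⟩, fun j => ⟨σ.symm j, by simp [hu], ?_⟩⟩
    · intro j hj
      by_contra hne
      exact hj (by simp [Ne.symm hne])
    · intro i hi
      by_contra hne
      refine hi ?_
      have : σ i ≠ j := fun h => hne (by rw [← h]; simp)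
      simp [this]

theorem IsMonomial.one : IsMonomial (1 : Matrix (Fin n) (Fin n) F) :=
  (isMonomial_iff _).2 ⟨1, fun _ => 1, fun _ => one_ne_zero, by
    ext i j; by_cases h : i = j <;> simp [Matrix.one_apply, h]⟩

theorem IsMonomial.mul {P Q : Matrix (Fin n) (Fin n) F} (hP : IsMonomial P)
    (hQ : IsMonomial Q) : IsMonomial (P * Q) := by
  obtain ⟨σ, u, hu, rfl⟩ := (isMonomial_iff _).1 hP
  obtain ⟨τ, v, hv, rfl⟩ := (isMonomial_iff _).1 hQ
  refine (isMonomial_iff _).2 ⟨σ.trans τ, fun i => u i * v (σ i),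
    fun i => mul_ne_zero (hu i) (hv _), ?_⟩
  ext i j
  rw [Matrix.mul_apply, Finset.sum_eq_single (σ i)]
  · by_cases h : τ (σ i) = j <;> simp [h]
  · intro b _ hb
    simp [Ne.symm hb]
  · simp

theorem IsMonomial.exists_inv {P : Matrix (Fin n) (Fin n) F} (hP : IsMonomial P) :
    ∃ Q : Matrix (Fin n) (Fin n) F, IsMonomial Q ∧ P * Q = 1 := by
  obtain ⟨σ, u, hu, rfl⟩ := (isMonomial_iff _).1 hP
  refine ⟨Matrix.of fun i j => if σ.symm i = j then (u (σ.symm i))⁻¹ else 0,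
    (isMonomial_iff _).2 ⟨σ.symm, fun i => (u (σ.symm i))⁻¹, fun i => inv_ne_zero (hu _), rfl⟩, ?_⟩
  ext i j
  rw [Matrix.mul_apply, Finset.sum_eq_single (σ i)]
  · by_cases h : i = j
    · subst h
      simp [hu]
    · simp [h]
  · intro b _ hb
    simp [Ne.symm hb]
  · simp

theorem codeEquiv_equivalence :
    Equivalence (CodeEquiv : Submodule F (Fin n → F) → Submodule F (Fin n → F) → Prop) where
  refl C := ⟨1, IsMonomial.one, by ext x; simp⟩
  symm := by
    rintro C₁ C₂ ⟨P, hP, h⟩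
    obtain ⟨Q, hQ, hPQ⟩ := hP.exists_inv
    refine ⟨Q, hQ, ?_⟩
    ext x
    have key : ∀ c, c ∈ C₂ ↔ ∃ c' ∈ C₁, c = Matrix.vecMul c' P := fun c => by
      rw [← SetLike.mem_coe, h]; rfl
    simp only [SetLike.mem_coe, Set.mem_ofPred_eq]
    constructor
    · intro hx
      exact ⟨Matrix.vecMul x P, (key _).2 ⟨x, hx, rfl⟩, by simp [Matrix.vecMul_vecMul, hPQ]⟩
    · rintro ⟨c, hc, rfl⟩
      obtain ⟨c', hc', rfl⟩ := (key c).1 hc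
      simpa [Matrix.vecMul_vecMul, hPQ] using hc'
  trans := by
    rintro C₁ C₂ C₃ ⟨P, hP, h⟩ ⟨Q, hQ, h'⟩
    refine ⟨P * Q, hP.mul hQ, ?_⟩
    have key : ∀ c, c ∈ C₂ ↔ ∃ c' ∈ C₁, c = Matrix.vecMul c' P := fun c => by
      rw [← SetLike.mem_coe, h]; rfl
    rw [h']
    ext x
    simp only [Set.mem_ofPred_eq]
    constructor
    · rintro ⟨c, hc, rfl⟩
      obtain ⟨c', hc', rfl⟩ := (key c).1 hc
      exact ⟨c', hc', by simp [Matrix.vecMul_vecMul]⟩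
    · rintro ⟨c, hc, rfl⟩
      exact ⟨Matrix.vecMul c P, (key _).2 ⟨c, hc, rfl⟩, by simp [Matrix.vecMul_vecMul]⟩

end Codes

/-- The LCD `[n, k, d]` codes over `F` with dual distance at least `2`. -/
def LCDCodes (F : Type*) [Field F] [DecidableEq F] (n k : ℕ) (d : ℤ) : Type _ :=
  {C : Submodule F (Fin n → F) // IsLCD C ∧ HasParams C k d ∧ 2 ≤ minWeight (dualCode C)}

/-- Equivalence of codes, restricted to the LCD `[n, k, d]` codes with dual distance at
least `2`. -/
def lcdSetoid (F : Type*) [Field F] [DecidableEq F] (n k : ℕ) (d : ℤ) :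
    Setoid (LCDCodes F n k d) where
  r C₁ C₂ := CodeEquiv C₁.1 C₂.1
  iseqv := ⟨fun C => codeEquiv_equivalence.refl C.1, codeEquiv_equivalence.symm,
    codeEquiv_equivalence.trans⟩

/-- The equivalence classes of LCD `[n, k, d]` codes over `F` with dual distance at
least `2`. -/
def LCDClasses (F : Type*) [Field F] [DecidableEq F] (n k : ℕ) (d : ℤ) : Type _ :=
  Quotient (lcdSetoid F n k d)

/-- `[k]_q = (q ^ k - 1) / (q - 1)`; the division is exact for `q ≥ 2`. -/
def qNumber (q k : ℕ) : ℕ := (q ^ k - 1) / (q - 1)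

/-- `r_{q,n,k,d} = q ^ (k - 1) n - [k]_q d`. -/
def rParam (q n k : ℕ) (d : ℤ) : ℤ := (q : ℤ) ^ (k - 1) * n - qNumber q k * d

/-- `s'_{q,n,k,d} = (q r_{q,n,k,d} - t) / [k]_q + 1`, where `t` is the remainder of `n` modulo
`[k]_q`.  The division is exact for `q ≥ 2` and `k ≥ 1`. -/
def sParam (q n k : ℕ) (d : ℤ) : ℤ :=
  (q * rParam q n k d - (n % qNumber q k : ℕ)) / (qNumber q k : ℤ) + 1

end LCDCode

/-! A code of dimension `k` is given by the columns of a generator matrix, seen as functionals on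
`F^k`. Dual distance at least 2 says that no column is zero, so up to monomial equivalence the code
is a multiplicity function on the points of the dual projective space, taken up to linear
automorphisms. Weights depend only on the multiplicities. Because `c * c = 1` for every unit of a
field with 2 or 3 elements, so does the Gram form, and hence so does the LCD property.

Raising every multiplicity by `e` appends `e` simplex codes. This adds `q^(k-1) e` to every nonzero
weight (`wt_one`) and leaves the Gram form unchanged (`gram_one`), so LCD codes go to LCD codes
(`isLCDMult_add_const_iff`). Conversely, averaging weights off a hyperplane shows that every point
has multiplicity at least `q d - (q-1) n` (`le_mult_of_le_wt`). For the parameters at hand this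
number is exactly `s - (s' - 1)`, so that many simplex copies can be removed again. Constant
functions are invariant under linear automorphisms, which makes this a bijection on equivalence
classes and gives (i).

For (ii), the code may have `z` zero columns. Shifting by `s - (s' - 1)`, of either sign, leaves
length `q r` with `z` columns still to be filled. For `k ≥ 3` all of them are filled with one
suitable functional (`IsLCDMult.exists_add_columns`). For `q = 3`, `k = 2` the multiplicity bound
forces `r ≥ 2` when `z > 0`, and explicit codes exist (`exists_isLCDMult_ternary_two`). -/

open Module
open scoped LinearAlgebra.Projectivization

namespace LCDCode

/-! ### Families of vectors and their multiplicities on projective points. -/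

section Multiplicity

variable {F : Type*} [Field F] {W : Type*} [AddCommGroup W] [Module F W]

open Classical in
/-- The number of members of the family `g` that represent the projective point `P`. -/
noncomputable def mult {ι : Type*} [Fintype ι] (g : ι → W) (P : ℙ F W) : ℕ :=
  (Finset.univ.filter fun i => ∃ h : g i ≠ 0, Projectivization.mk F (g i) h = P).card

/-- A function invariant under units descends to projective points, and zero vectors contribute
nothing. Weights, Gram forms and column counts are all computed from multiplicities through this
identity. -/
theorem sum_family {M : Type*} [AddCommMonoid M] [Fintype (ℙ F W)] {ι : Type*} [Fintype ι]
    (g : ι → W) (f : W → M) (h0 : f 0 = 0) (hf : ∀ (c : Fˣ) w, f (c • w) = f w) :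
    ∑ i, f (g i) = ∑ P : ℙ F W, mult g P • f P.rep := by
  classical
  have h1 : ∀ i, f (g i) = ∑ P : ℙ F W,
      if ∃ h : g i ≠ 0, Projectivization.mk F (g i) h = P then f P.rep else 0 := by
    intro i
    by_cases hi : g i = 0
    · simp [hi, h0]
    · rw [Finset.sum_eq_single (Projectivization.mk F (g i) hi)]
      · rw [if_pos ⟨hi, rfl⟩]
        obtain ⟨a, ha⟩ := Projectivization.exists_smul_eq_mk_rep F (g i) hi
        rw [← ha, hf]
      · rintro P - hP
        rw [if_neg]
        rintro ⟨h, rfl⟩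
        exact hP rfl
      · simp
  simp_rw [h1]
  rw [Finset.sum_comm]
  refine Finset.sum_congr rfl fun P _ => ?_
  rw [← Finset.sum_filter, Finset.sum_const, mult]

theorem sum_mult [Fintype (ℙ F W)] {ι : Type*} [Fintype ι] [DecidableEq W] (g : ι → W) :
    ∑ P : ℙ F W, mult g P = (Finset.univ.filter fun i => g i ≠ 0).card := by
  have := sum_family (F := F) g (fun w => if w ≠ 0 then 1 else 0) (by simp)
    (by simp [smul_eq_zero_iff_eq])
  rw [Finset.card_filter, this]
  simp [Projectivization.rep_nonzero]

theorem sum_mult_of_ne_zero [Fintype (ℙ F W)] {ι : Type*} [Fintype ι] (g : ι → W)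
    (hg : ∀ i, g i ≠ 0) : ∑ P : ℙ F W, mult g P = Fintype.card ι := by
  classical
  rw [sum_mult, Finset.filter_true_of_mem (fun i _ => hg i), Finset.card_univ]

theorem mult_id [Fintype F] [Fintype W] (P : ℙ F W) :
    mult (fun w : W => w) P = Fintype.card F - 1 := by
  classical
  rw [mult, ← Fintype.card_units, ← Finset.card_univ]
  symm
  refine Finset.card_bij (fun c _ => c • P.rep) ?_ ?_ ?_
  · intro c _
    rw [Finset.mem_filter]
    have hne : c • P.rep ≠ 0 := by simpa [smul_eq_zero_iff_eq] using P.rep_nonzero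
    refine ⟨Finset.mem_univ _, hne, ?_⟩
    conv_rhs => rw [← P.mk_rep]
    exact (Projectivization.mk_eq_mk_iff F _ _ _ _).2 ⟨c, rfl⟩
  · intro c _ c' _ h
    have : ((c : F) - c') • P.rep = 0 := by
      rw [sub_smul, sub_eq_zero]; exact h
    rcases smul_eq_zero.1 this with h | h
    · exact Units.ext (sub_eq_zero.1 h)
    · exact (P.rep_nonzero h).elim
  · intro w hw
    rw [Finset.mem_filter] at hw
    obtain ⟨-, hne, rfl⟩ := hw
    obtain ⟨a, ha⟩ := Projectivization.exists_smul_eq_mk_rep F w hne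
    exact ⟨a⁻¹, Finset.mem_univ _, by rw [← ha, inv_smul_smul]⟩

theorem sum_eq_card_sub_one_nsmul [Fintype F] [Fintype W] [Fintype (ℙ F W)] {M : Type*}
    [AddCommMonoid M] (f : W → M) (h0 : f 0 = 0) (hf : ∀ (c : Fˣ) w, f (c • w) = f w) :
    ∑ w, f w = (Fintype.card F - 1) • ∑ P : ℙ F W, f P.rep := by
  rw [sum_family (F := F) (fun w => w) f h0 hf, Finset.smul_sum]
  simp_rw [mult_id]

theorem exists_family [Fintype (ℙ F W)] (m : ℙ F W → ℕ) {n : ℕ} (hm : ∑ P, m P = n) :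
    ∃ g : Fin n → W, (∀ i, g i ≠ 0) ∧ mult g = m := by
  classical
  have hc : Fintype.card (Σ P : ℙ F W, Fin (m P)) = n := by simp [hm]
  let e : Fin n ≃ Σ P : ℙ F W, Fin (m P) := (Fintype.equivFinOfCardEq hc).symm
  refine ⟨fun i => (e i).1.rep, fun i => Projectivization.rep_nonzero _, ?_⟩
  funext P
  have h1 : (Finset.univ.filter fun i => ∃ h : (e i).1.rep ≠ 0,
      Projectivization.mk F (e i).1.rep h = P) = Finset.univ.filter fun i => (e i).1 = P := by
    ext i
    simp [Projectivization.rep_nonzero]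
  rw [mult, h1, Finset.card_filter,
    Equiv.sum_comp e (fun x : Σ P : ℙ F W, Fin (m P) => if x.1 = P then 1 else 0),
    Fintype.sum_sigma, Finset.sum_eq_single P]
  · simp
  · intro Q _ hQ
    simp [hQ]
  · simp

/-- Over each projective point the two index fibres have the same size. Bijections of the fibres
glue to a permutation, and representatives of one point differ by a unit. -/
theorem exists_perm_of_mult_eq {ι : Type*} [Fintype ι] (g h : ι → W) (hg : ∀ i, g i ≠ 0)
    (hh : ∀ i, h i ≠ 0) (H : (mult g : ℙ F W → ℕ) = mult h) :
    ∃ (σ : Equiv.Perm ι) (u : ι → F), (∀ i, u i ≠ 0) ∧ ∀ i, h (σ i) = u i • g i := by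
  classical
  let a : ι → ℙ F W := fun i => Projectivization.mk F (g i) (hg i)
  let b : ι → ℙ F W := fun i => Projectivization.mk F (h i) (hh i)
  have key : ∀ P, Nonempty ({i // a i = P} ≃ {i // b i = P}) := by
    intro P
    refine Fintype.card_eq.1 ?_
    have := congrFun H P
    simp only [mult, hg, hh, ne_eq, not_false_eq_true, exists_true_left] at this
    rw [Fintype.card_subtype, Fintype.card_subtype]
    exact this
  let e := fun P => (key P).some
  let σ : Equiv.Perm ι := Equiv.ofFiberEquiv e
  have hσ : ∀ i, b (σ i) = a i := Equiv.ofFiberEquiv_map e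
  have : ∀ i, ∃ c : Fˣ, c • g i = h (σ i) := fun i =>
    (Projectivization.mk_eq_mk_iff F _ _ _ _).1 (hσ i)
  choose u hu using this
  exact ⟨σ, fun i => u i, fun i => (u i).ne_zero, fun i => (hu i).symm⟩

theorem mult_eq_of_perm {ι : Type*} [Fintype ι] (g h : ι → W) (σ : Equiv.Perm ι) (u : ι → F)
    (hu : ∀ i, u i ≠ 0) (H : ∀ i, h (σ i) = u i • g i) : (mult g : ℙ F W → ℕ) = mult h := by
  classical
  funext P
  refine Finset.card_bij (fun i _ => σ i) ?_ (fun _ _ _ _ h => σ.injective h) ?_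
  · intro i hi
    rw [Finset.mem_filter] at hi ⊢
    obtain ⟨-, hne, rfl⟩ := hi
    refine ⟨Finset.mem_univ _, by rw [H]; exact smul_ne_zero (hu i) hne, ?_⟩
    exact (Projectivization.mk_eq_mk_iff' F _ _ _ _).2 ⟨u i, (H i).symm⟩
  · intro j hj
    rw [Finset.mem_filter] at hj
    obtain ⟨-, hne, rfl⟩ := hj
    have h2 : h j = u (σ.symm j) • g (σ.symm j) := by rw [← H, Equiv.apply_symm_apply]
    have hg : g (σ.symm j) ≠ 0 := fun h0 => hne (by rw [h2, h0, smul_zero])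
    refine ⟨σ.symm j, ?_, by simp⟩
    rw [Finset.mem_filter]
    exact ⟨Finset.mem_univ _, hg,
      ((Projectivization.mk_eq_mk_iff' F _ _ _ _).2 ⟨_, h2.symm⟩).symm⟩

theorem mult_comp_equiv {ι : Type*} [Fintype ι] (A : W ≃ₗ[F] W) (g : ι → W) (P : ℙ F W) :
    mult (fun i => A (g i)) (P.map A.toLinearMap A.injective) = mult g P := by
  classical
  unfold mult
  congr 1
  refine Finset.filter_congr fun i _ => ?_
  constructor
  · rintro ⟨h, h'⟩
    have hg : g i ≠ 0 := fun h0 => h (by simp [h0])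
    exact ⟨hg, Projectivization.map_injective A.toLinearMap A.injective h'⟩
  · rintro ⟨h, rfl⟩
    exact ⟨by simpa using h, rfl⟩

end Multiplicity

/-- `S` is a union of lines in direction `y`, and on each line `f` takes every value once, so it
vanishes at one point in `q`. -/
theorem card_mul_card_filter_ne_zero {F : Type*} [Field F] [Fintype F] [DecidableEq F]
    {E : Type*} [AddCommGroup E] [Module F E] (S : Finset E) (f : E →ₗ[F] F) (y : E)
    (hy : f y = 1) (hS : ∀ x ∈ S, ∀ c : F, x + c • y ∈ S) :
    Fintype.card F * (S.filter fun x => f x ≠ 0).card = (Fintype.card F - 1) * S.card := by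
  classical
  have h1 : ∀ c : F, (∑ x ∈ S, if f (x + c • y) ≠ 0 then 1 else 0) =
      (S.filter fun x => f x ≠ 0).card := by
    intro c
    rw [Finset.card_filter]
    refine Finset.sum_nbij' (fun x => x + c • y) (fun x => x + (-c) • y) (fun x hx => hS x hx c)
      (fun x hx => hS x hx (-c)) ?_ ?_ ?_
    · intro x _; simp
    · intro x _; simp
    · intro x _; rfl
  have h2 : ∀ x : E, (∑ c : F, if f (x + c • y) ≠ 0 then 1 else 0) = Fintype.card F - 1 := by
    intro x
    have h3 : (Finset.univ.filter fun c : F => f (x + c • y) ≠ 0) =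
        Finset.univ.erase (-f x) := by
      ext c
      simp [hy, eq_neg_iff_add_eq_zero, add_comm]
    rw [← Finset.card_filter, h3, Finset.card_erase_of_mem (Finset.mem_univ _), Finset.card_univ]
  have h4 := Finset.sum_comm (s := (Finset.univ : Finset F)) (t := S)
    (f := fun c x => if f (x + c • y) ≠ 0 then 1 else 0)
  simp_rw [h1, h2] at h4
  simpa [mul_comm] using h4

/-! ### Weight and Gram form of a multiplicity function; the lower bound on multiplicities. -/

section Weight

variable {F : Type*} [Field F] {V : Type*} [AddCommGroup V] [Module F V]
  [Fintype (ℙ F (Dual F V))]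

/-- The weight of the codeword belonging to `x`, for columns of multiplicities `m`. -/
noncomputable def wt [DecidableEq F] (m : ℙ F (Dual F V) → ℕ) (x : V) : ℕ :=
  ∑ P : ℙ F (Dual F V), m P * if P.rep x ≠ 0 then 1 else 0

/-- The Gram form of columns of multiplicities `m`. -/
noncomputable def gram (m : ℙ F (Dual F V) → ℕ) : V →ₗ[F] Dual F V :=
  ∑ P : ℙ F (Dual F V), (m P : F) • P.rep.smulRight P.rep

theorem wt_add [DecidableEq F] (m m' : ℙ F (Dual F V) → ℕ) (x : V) :
    wt (m + m') x = wt m x + wt m' x := by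
  simp only [wt, Pi.add_apply, add_mul, Finset.sum_add_distrib]

theorem wt_const [DecidableEq F] (e : ℕ) (x : V) :
    wt (fun _ : ℙ F (Dual F V) => e) x = e * wt (fun _ : ℙ F (Dual F V) => 1) x := by
  simp [wt, Finset.mul_sum]

theorem gram_add (m m' : ℙ F (Dual F V) → ℕ) : gram (m + m') = gram m + gram m' := by
  simp [gram, add_smul, Finset.sum_add_distrib]

theorem gram_const (e : ℕ) :
    gram (fun _ : ℙ F (Dual F V) => e) = (e : F) • gram (fun _ : ℙ F (Dual F V) => 1) := by
  simp [gram, Finset.smul_sum]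

theorem wt_single [DecidableEq F] [DecidableEq (ℙ F (Dual F V))] (P : ℙ F (Dual F V)) (z : ℕ)
    (x : V) : wt (Pi.single P z) x = z * if P.rep x ≠ 0 then 1 else 0 := by
  rw [wt, Finset.sum_eq_single P]
  · simp
  · intro Q _ hQ; simp [hQ]
  · simp

theorem gram_single [DecidableEq (ℙ F (Dual F V))] (P : ℙ F (Dual F V)) (z : ℕ) :
    gram (Pi.single P z) = (z : F) • P.rep.smulRight P.rep := by
  rw [gram, Finset.sum_eq_single P]
  · simp
  · intro Q _ hQ; simp [hQ]
  · simp

/-- Sum the weights over the vectors `x` off the hyperplane of `P₀`. The point `P₀` is nonzero on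
all of them, every other point on exactly a fraction `(q-1)/q`; comparing with `d` times the number
of vectors gives the bound. -/
theorem le_mult_of_le_wt [Fintype F] [DecidableEq F] [Finite V] (m : ℙ F (Dual F V) → ℕ) (d : ℕ)
    (hd : ∀ x, x ≠ 0 → d ≤ wt m x) (P₀ : ℙ F (Dual F V)) :
    Fintype.card F * d ≤ m P₀ + (Fintype.card F - 1) * ∑ P, m P := by
  classical
  have := Fintype.ofFinite V
  set q := Fintype.card F
  have hq : 1 ≤ q := Fintype.card_pos
  let S : Finset V := Finset.univ.filter fun x => P₀.rep x ≠ 0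
  have hSpos : 0 < S.card := by
    rw [Finset.card_pos]
    by_contra h
    rw [Finset.not_nonempty_iff_eq_empty, Finset.filter_eq_empty_iff] at h
    exact P₀.rep_nonzero (LinearMap.ext fun x => by simpa using h (Finset.mem_univ x))
  have hcount : ∀ P : ℙ F (Dual F V), P ≠ P₀ →
      q * (S.filter fun x => P.rep x ≠ 0).card = (q - 1) * S.card := by
    intro P hP
    have hli := (Projectivization.linearIndependent_pair_iff_ne (D := P₀) (D' := P)).2 hP.symm
    -- Translation by such a `y` preserves `S` while changing the value of `P`. If none existed, the
    -- kernel of `P₀` would lie in that of `P`, making the two functionals proportional.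
    have hex : ∃ y : V, P₀.rep y = 0 ∧ P.rep y = 1 := by
      by_contra hno
      push Not at hno
      have hker : LinearMap.ker P₀.rep ≤ LinearMap.ker P.rep := by
        intro y hy
        rw [LinearMap.mem_ker] at hy ⊢
        by_contra hne
        refine hno ((P.rep y)⁻¹ • y) (by simp [hy]) (by simp [hne])
      obtain ⟨z, hz⟩ : ∃ z, P₀.rep z ≠ 0 := by
        obtain ⟨z, hz⟩ := Finset.card_pos.1 hSpos
        exact ⟨z, (Finset.mem_filter.1 hz).2⟩
      have : P.rep = (P.rep z / P₀.rep z) • P₀.rep := by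
        ext x
        have : x - (P₀.rep x / P₀.rep z) • z ∈ LinearMap.ker P₀.rep := by
          simp [hz]
        have := hker this
        simp only [LinearMap.mem_ker, map_sub, map_smul, smul_eq_mul, sub_eq_zero] at this
        rw [this, LinearMap.smul_apply, smul_eq_mul]
        ring
      exact (LinearIndependent.pair_iff' P₀.rep_nonzero).1 hli _ this.symm
    obtain ⟨y, hy0, hy1⟩ := hex
    exact card_mul_card_filter_ne_zero S P.rep y hy1 fun x hx c => by
      simpa [S, hy0] using hx
  have hsum : ∑ x ∈ S, wt m x = ∑ P, m P * (S.filter fun x => P.rep x ≠ 0).card := by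
    simp_rw [wt]
    rw [Finset.sum_comm]
    refine Finset.sum_congr rfl fun P _ => ?_
    rw [← Finset.mul_sum, Finset.card_filter]
  have hle : S.card * d ≤ ∑ x ∈ S, wt m x := by
    rw [← smul_eq_mul]
    refine Finset.card_nsmul_le_sum _ _ _ fun x hx => hd x ?_
    rintro rfl
    simp [S] at hx
  have hP₀ : (S.filter fun x => P₀.rep x ≠ 0).card = S.card := by
    congr 1
    exact Finset.filter_true_of_mem fun x hx => (Finset.mem_filter.1 hx).2
  have hbound : ∀ P, q * (m P * (S.filter fun x => P.rep x ≠ 0).card) ≤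
      (if P = P₀ then m P * S.card else 0) + (q - 1) * (m P * S.card) := by
    intro P
    obtain ⟨p, hp⟩ := Nat.exists_eq_add_of_le hq
    split_ifs with h
    · subst h
      rw [hP₀, hp, Nat.add_sub_cancel_left]
      exact le_of_eq (by ring)
    · rw [zero_add, mul_left_comm, hcount P h]
      exact le_of_eq (by ring)
  have : S.card * (q * d) ≤ S.card * (m P₀ + (q - 1) * ∑ P, m P) := by
    calc S.card * (q * d) = q * (S.card * d) := by ring
      _ ≤ q * ∑ P, m P * (S.filter fun x => P.rep x ≠ 0).card :=
        Nat.mul_le_mul_left _ (hsum ▸ hle)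
      _ ≤ ∑ P, ((if P = P₀ then m P * S.card else 0) + (q - 1) * (m P * S.card)) := by
        rw [Finset.mul_sum]
        exact Finset.sum_le_sum fun P _ => hbound P
      _ = S.card * (m P₀ + (q - 1) * ∑ P, m P) := by
        rw [Finset.sum_add_distrib, Finset.sum_ite_eq' Finset.univ P₀, if_pos (Finset.mem_univ _),
          ← Finset.mul_sum, ← Finset.sum_mul]
        ring
  exact Nat.le_of_mul_le_mul_left this hSpos

end Weight

/-! ### The simplex code: every point once. -/

section Simplex

variable {F : Type*} [Field F] [Fintype F] {k : ℕ}
  [Fintype (ℙ F (Dual F (Fin k → F)))]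

theorem wt_one [DecidableEq F] (hk : 1 ≤ k) (x : Fin k → F) (hx : x ≠ 0) :
    wt (fun _ : ℙ F (Dual F (Fin k → F)) => 1) x = Fintype.card F ^ (k - 1) := by
  classical
  have : Finite (Dual F (Fin k → F)) := Finite.of_equiv _ (dotProductEquiv F (Fin k)).toEquiv
  have := Fintype.ofFinite (Dual F (Fin k → F))
  have hq : 1 < Fintype.card F := Fintype.one_lt_card
  have hcard : Fintype.card (Dual F (Fin k → F)) = Fintype.card F ^ k := by
    rw [← Fintype.card_congr (dotProductEquiv F (Fin k)).toEquiv]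
    simp
  obtain ⟨i, hi⟩ := Function.ne_iff.1 hx
  have h1 : Fintype.card F * (Finset.univ.filter fun φ : Dual F (Fin k → F) => φ x ≠ 0).card =
      (Fintype.card F - 1) * Fintype.card (Dual F (Fin k → F)) :=
    card_mul_card_filter_ne_zero Finset.univ
    (Dual.eval F (Fin k → F) x) ((x i)⁻¹ • LinearMap.proj i) (by simpa using inv_mul_cancel₀ hi)
    (by simp)
  have h2 := sum_eq_card_sub_one_nsmul (F := F) (W := Dual F (Fin k → F))
    (fun φ => if φ x ≠ 0 then 1 else 0) (by simp) (by simp [Units.smul_def])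
  rw [← Finset.card_filter] at h2
  rw [h2, hcard, smul_eq_mul, mul_left_comm] at h1
  have h3 := Nat.eq_of_mul_eq_mul_left (by omega) h1
  obtain ⟨j, rfl⟩ := Nat.exists_eq_add_of_le' hk
  rw [pow_succ', Nat.add_sub_cancel] at *
  have h4 := Nat.eq_of_mul_eq_mul_left (by omega) h3
  simpa [wt] using h4

/-- Summing `φ x * φ y` over all functionals sums a polynomial of degree at most 2 over `F^k`, which
is zero since `2 < (q-1) k`. That sum is also `q - 1 = -1` times the Gram form. -/
theorem gram_one (hk : 2 < (Fintype.card F - 1) * k) (hu : ∀ c : Fˣ, (c : F) * c = 1) :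
    gram (fun _ : ℙ F (Dual F (Fin k → F)) => 1) = 0 := by
  classical
  have : Finite (Dual F (Fin k → F)) := Finite.of_equiv _ (dotProductEquiv F (Fin k)).toEquiv
  have := Fintype.ofFinite (Dual F (Fin k → F))
  have hq : 1 < Fintype.card F := Fintype.one_lt_card
  refine LinearMap.ext fun x => LinearMap.ext fun y => ?_
  have h2 := sum_eq_card_sub_one_nsmul (F := F) (W := Dual F (Fin k → F))
    (fun φ => φ x * φ y) (by simp) (by
      intro c w
      simp only [Units.smul_def, LinearMap.smul_apply, smul_eq_mul]
      rw [mul_mul_mul_comm, hu, one_mul])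
  let p : (Fin k → F) → MvPolynomial (Fin k) F := fun v =>
    ∑ i, MvPolynomial.C (v i) * MvPolynomial.X i
  have hp : ∀ v, (p v).totalDegree ≤ 1 := by
    intro v
    refine MvPolynomial.totalDegree_finsetSum_le fun i _ => ?_
    refine (MvPolynomial.totalDegree_mul _ _).trans ?_
    simp
  have h3 := MvPolynomial.sum_eval_eq_zero (p x * p y) (by
    refine lt_of_le_of_lt ((MvPolynomial.totalDegree_mul _ _).trans (add_le_add (hp x) (hp y))) ?_
    simpa using hk)
  have h4 : ∑ φ : Dual F (Fin k → F), φ x * φ y = 0 := by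
    rw [← h3, ← Equiv.sum_comp (dotProductEquiv F (Fin k)).toEquiv]
    refine Finset.sum_congr rfl fun v _ => ?_
    simp [p, dotProduct, mul_comm]
  rw [h4, nsmul_eq_mul, Nat.cast_sub hq.le, FiniteField.cast_card_eq_zero] at h2
  simpa [gram] using h2.symm

end Simplex

/-! ### Codes from columns: dual distance, equivalence, LCD property. -/

section Generators

variable {F : Type*} [Field F] {k n : ℕ}

/-- The code generated by the matrix with columns `g`, seen as linear functionals. -/
def codeOf (g : Fin n → Dual F (Fin k → F)) : Submodule F (Fin n → F) :=
  LinearMap.range (LinearMap.pi g)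

theorem exists_codeOf_eq (C : Submodule F (Fin n → F)) (hC : finrank F C = k) :
    ∃ g : Fin n → Dual F (Fin k → F), Function.Injective (LinearMap.pi g) ∧ codeOf g = C := by
  let e : (Fin k → F) ≃ₗ[F] C := LinearEquiv.ofFinrankEq _ _ (by simp [hC])
  have h : LinearMap.pi (fun i => LinearMap.proj i ∘ₗ C.subtype ∘ₗ e.toLinearMap) =
      C.subtype ∘ₗ e.toLinearMap := by
    ext; rfl
  refine ⟨fun i => LinearMap.proj i ∘ₗ C.subtype ∘ₗ e.toLinearMap, ?_, ?_⟩
  · rw [h]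
    exact C.subtype_injective.comp e.injective
  · rw [codeOf, h, LinearMap.range_comp, LinearEquiv.range, Submodule.map_top,
      Submodule.range_subtype]

theorem le_minWeight_iff [DecidableEq F] (C : Submodule F (Fin n → F)) (d : ℕ) :
    (d : ℕ∞) ≤ minWeight C ↔ ∀ c ∈ C, c ≠ 0 → d ≤ hammingNorm c := by
  simp [minWeight]

theorem minWeight_eq_iff [DecidableEq F] (C : Submodule F (Fin n → F)) (d : ℕ) :
    minWeight C = d ↔
      (∀ c ∈ C, c ≠ 0 → d ≤ hammingNorm c) ∧ ∃ c ∈ C, c ≠ 0 ∧ hammingNorm c = d := by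
  constructor
  · intro h
    have h1 := (le_minWeight_iff C d).1 h.ge
    refine ⟨h1, ?_⟩
    by_contra hno
    push Not at hno
    have : ((d + 1 : ℕ) : ℕ∞) ≤ minWeight C :=
      (le_minWeight_iff C _).2 fun c hc h0 => lt_of_le_of_ne (h1 c hc h0) (hno c hc h0).symm
    rw [h, Nat.cast_le] at this
    omega
  · rintro ⟨h1, c, hc, h0, rfl⟩
    exact le_antisymm (iInf₂_le_of_le c hc (iInf_le _ h0)) ((le_minWeight_iff C _).2 h1)

/-- A dual word of weight one forces the column at its single nonzero coordinate to vanish, and a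
zero column produces such a word. -/
theorem two_le_minWeight_dualCode_iff [DecidableEq F] (g : Fin n → Dual F (Fin k → F)) :
    2 ≤ minWeight (dualCode (codeOf g)) ↔ ∀ i, g i ≠ 0 := by
  rw [show (2 : ℕ∞) = ((2 : ℕ) : ℕ∞) from rfl, le_minWeight_iff]
  constructor
  · intro h i hi
    have h1 : hammingNorm (Pi.single i 1 : Fin n → F) ≤ 1 := by
      rw [hammingNorm]
      refine Finset.card_le_one.2 fun a ha b hb => ?_
      simp only [Finset.mem_filter, Finset.mem_univ, true_and, ne_eq, Pi.single_apply,
        ite_eq_right_iff, one_ne_zero, imp_false, not_not] at ha hb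
      rw [ha, hb]
    have := h (Pi.single i 1) (by
      rintro _ ⟨x, rfl⟩
      simp [hi]) (by simp)
    omega
  · intro h c hc h0
    by_contra hlt
    have h1 : hammingNorm c ≤ 1 := by omega
    obtain ⟨i, hi⟩ := Function.ne_iff.1 h0
    have h2 : ∀ j, j ≠ i → c j = 0 := by
      intro j hj
      by_contra hc0
      exact hj (Finset.card_le_one.1 h1 j (by simpa using hc0) i (by simpa using hi))
    refine h i (LinearMap.ext fun x => ?_)
    have h3 := hc _ ⟨x, rfl⟩
    rw [dotProduct, Finset.sum_eq_single i (fun j _ hj => by rw [h2 j hj, zero_mul]) (by simp)] at h3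
    exact (mul_eq_zero.1 h3).resolve_left hi

/-- A monomial matrix permutes and rescales columns, which multiplicities do not see; what remains
is the change of basis of the message space, acting on functionals as `A`. -/
theorem codeEquiv_codeOf_iff [Fintype F] (g h : Fin n → Dual F (Fin k → F))
    (hg : Function.Injective (LinearMap.pi g)) (hh : Function.Injective (LinearMap.pi h))
    (hg0 : ∀ i, g i ≠ 0) (hh0 : ∀ i, h i ≠ 0) :
    CodeEquiv (codeOf g) (codeOf h) ↔ ∃ A : Dual F (Fin k → F) ≃ₗ[F] Dual F (Fin k → F),
      (mult h : ℙ F (Dual F (Fin k → F)) → ℕ) = mult fun i => A (g i) := by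
  constructor
  · rintro ⟨P, hP, hC⟩
    obtain ⟨σ, u, hu, rfl⟩ := (isMonomial_iff P).1 hP
    have hmul : ∀ (c : Fin n → F) i, Matrix.vecMul c
        (Matrix.of fun i j => if σ i = j then u i else 0) (σ i) = c i * u i := by
      intro c i
      simp [Matrix.vecMul, dotProduct]
    have hmem : ∀ c, c ∈ codeOf h ↔ ∃ c' ∈ codeOf g, c = Matrix.vecMul c'
        (Matrix.of fun i j => if σ i = j then u i else 0) := fun c => by
      rw [← SetLike.mem_coe, hC]; rfl
    have hex : ∀ x, ∃ y, ∀ i, h (σ i) y = g i x * u i := by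
      intro x
      obtain ⟨y, hy⟩ := (hmem _).2 ⟨_, ⟨x, rfl⟩, rfl⟩
      exact ⟨y, fun i => (congrFun hy (σ i)).trans (hmul _ i)⟩
    choose B hB using hex
    have huniq : ∀ y z, (∀ i, h (σ i) y = h (σ i) z) → y = z := by
      intro y z hyz
      refine hh (funext fun j => ?_)
      simpa using hyz (σ.symm j)
    let B' : (Fin k → F) →ₗ[F] (Fin k → F) :=
      { toFun := B
        map_add' := fun x y => huniq _ _ fun i => by simp [hB, add_mul]
        map_smul' := fun c x => huniq _ _ fun i => by simp [hB, mul_assoc] }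
    have hBinj : Function.Injective B' := by
      intro x y hxy
      refine hg (funext fun i => ?_)
      have h1 : h (σ i) (B x) = h (σ i) (B y) := congrArg _ hxy
      rw [hB, hB] at h1
      exact mul_right_cancel₀ (hu i) h1
    let e := LinearEquiv.ofInjectiveEndo B' hBinj
    refine ⟨e.symm.dualMap, ?_⟩
    refine (mult_eq_of_perm _ h σ u hu fun i => LinearMap.ext fun y => ?_).symm
    obtain ⟨x, rfl⟩ := e.surjective y
    have : h (σ i) (e x) = g i x * u i := hB x i
    simp [this, mul_comm]
  · rintro ⟨A, hA⟩
    obtain ⟨σ, u, hu, H⟩ := exists_perm_of_mult_eq (F := F) (fun i => A (g i)) h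
      (fun i => by simpa using hg0 i) hh0 hA.symm
    have hmul : ∀ (c : Fin n → F) i, Matrix.vecMul c
        (Matrix.of fun i j => if σ i = j then u i else 0) (σ i) = c i * u i := by
      intro c i
      simp [Matrix.vecMul, dotProduct]
    -- By reflexivity, `A` is the transpose of an automorphism of the message space.
    let e : (Fin k → F) ≃ₗ[F] (Fin k → F) :=
      (evalEquiv F (Fin k → F)).trans (A.dualMap.trans (evalEquiv F (Fin k → F)).symm)
    have he : ∀ (φ : Dual F (Fin k → F)) x, φ (e x) = A φ x := by
      intro φ x
      simp [e]
    have key : ∀ x, (fun j => h j x) = Matrix.vecMul (fun i => g i (e x))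
        (Matrix.of fun i j => if σ i = j then u i else 0) := by
      intro x
      funext j
      obtain ⟨i, rfl⟩ := σ.surjective j
      rw [hmul, he, H, LinearMap.smul_apply, smul_eq_mul, mul_comm]
    refine ⟨_, (isMonomial_iff _).2 ⟨σ, u, hu, rfl⟩, ?_⟩
    ext c
    simp only [SetLike.mem_coe, Set.mem_ofPred_eq]
    constructor
    · rintro ⟨x, rfl⟩
      exact ⟨_, ⟨e x, rfl⟩, key x⟩
    · rintro ⟨_, ⟨x, rfl⟩, rfl⟩
      obtain ⟨y, rfl⟩ := e.surjective x
      exact ⟨y, key y⟩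

variable [Fintype (ℙ F (Dual F (Fin k → F)))]

theorem hammingNorm_pi [DecidableEq F] (g : Fin n → Dual F (Fin k → F)) (x : Fin k → F) :
    hammingNorm (LinearMap.pi g x) = wt (mult g) x := by
  have := sum_family (F := F) g (fun φ => if φ x ≠ 0 then 1 else 0) (by simp)
    (by simp [Units.smul_def])
  rw [hammingNorm, Finset.card_filter]
  exact this

theorem dotProduct_pi (hu : ∀ c : Fˣ, (c : F) * c = 1) (g : Fin n → Dual F (Fin k → F))
    (x y : Fin k → F) :
    LinearMap.pi g x ⬝ᵥ LinearMap.pi g y = gram (mult g) x y := by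
  have := sum_family (F := F) g (fun φ => φ x * φ y) (by simp) (by
    intro c w
    simp only [Units.smul_def, LinearMap.smul_apply, smul_eq_mul]
    rw [mul_mul_mul_comm, hu, one_mul])
  simpa [gram, dotProduct] using this

/-- The multiplicities `m` are those of the columns of an LCD code of minimum weight `d`. -/
def IsLCDMult [DecidableEq F] (m : ℙ F (Dual F (Fin k → F)) → ℕ) (d : ℕ) : Prop :=
  (∀ x, x ≠ 0 → d ≤ wt m x) ∧ (∃ x, x ≠ 0 ∧ wt m x = d) ∧ ∀ x, gram m x = 0 → x = 0

theorem isLCD_codeOf_iff (hu : ∀ c : Fˣ, (c : F) * c = 1) (g : Fin n → Dual F (Fin k → F))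
    (hg : Function.Injective (LinearMap.pi g)) :
    IsLCD (codeOf g) ↔ ∀ x, gram (mult g) x = 0 → x = 0 := by
  rw [IsLCD, Submodule.eq_bot_iff]
  constructor
  · intro h x hx
    refine hg ((h (LinearMap.pi g x) ⟨⟨x, rfl⟩, ?_⟩).trans (map_zero _).symm)
    rintro _ ⟨y, rfl⟩
    rw [dotProduct_pi hu, hx, LinearMap.zero_apply]
  · rintro h _ ⟨⟨x, rfl⟩, hx⟩
    rw [h x (LinearMap.ext fun y => ?_), map_zero]
    rw [← dotProduct_pi hu]
    exact hx _ ⟨y, rfl⟩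

theorem isLCDMult_mult [DecidableEq F] (hu : ∀ c : Fˣ, (c : F) * c = 1)
    (g : Fin n → Dual F (Fin k → F)) (hg : Function.Injective (LinearMap.pi g)) (d : ℕ)
    (hL : IsLCD (codeOf g)) (hd : HasParams (codeOf g) k d) : IsLCDMult (mult g) d := by
  obtain ⟨-, m, hm, hmd⟩ := hd
  obtain rfl : m = d := by exact_mod_cast hmd
  obtain ⟨h1, _, ⟨x, rfl⟩, h0, h2⟩ := (minWeight_eq_iff _ _).1 hm
  refine ⟨fun y hy => ?_, ⟨x, ?_, ?_⟩, (isLCD_codeOf_iff hu g hg).1 hL⟩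
  · rw [← hammingNorm_pi]
    exact h1 _ ⟨y, rfl⟩ ((map_ne_zero_iff _ hg).2 hy)
  · rintro rfl
    exact h0 (map_zero _)
  · rw [← hammingNorm_pi, h2]

/-- Positivity of `d` makes the encoding map injective, so the dimension is the full `k`. -/
theorem IsLCDMult.codeOf [DecidableEq F] (hu : ∀ c : Fˣ, (c : F) * c = 1)
    (g : Fin n → Dual F (Fin k → F)) (d : ℕ) (hd : 0 < d) (h : IsLCDMult (mult g) d) :
    Function.Injective (LinearMap.pi g) ∧ IsLCD (codeOf g) ∧ HasParams (codeOf g) k d := by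
  obtain ⟨h1, ⟨x, hx0, hx⟩, h3⟩ := h
  have hg : Function.Injective (LinearMap.pi g) := by
    rw [← LinearMap.ker_eq_bot, LinearMap.ker_eq_bot']
    intro y hy
    by_contra h0
    have := h1 y h0
    rw [← hammingNorm_pi, hy, hammingNorm_zero] at this
    omega
  refine ⟨hg, (isLCD_codeOf_iff hu g hg).2 h3, ?_, d, (minWeight_eq_iff _ _).2 ⟨?_, ?_⟩, rfl⟩
  · rw [LCDCode.codeOf, LinearMap.finrank_range_of_inj hg]
    simp
  · rintro _ ⟨y, rfl⟩ h0
    rw [hammingNorm_pi]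
    refine h1 y ?_
    rintro rfl
    exact h0 (map_zero _)
  · exact ⟨_, ⟨x, rfl⟩, (map_ne_zero_iff _ hg).2 hx0, by rw [hammingNorm_pi, hx]⟩

end Generators

theorem card_projectivization_dual (F : Type*) [Field F] [Fintype F] (k : ℕ)
    [Fintype (ℙ F (Dual F (Fin k → F)))] :
    Fintype.card (ℙ F (Dual F (Fin k → F))) = qNumber (Fintype.card F) k := by
  have hc : Nat.card (Dual F (Fin k → F)) = Fintype.card F ^ k := by
    rw [← Nat.card_congr (dotProductEquiv F (Fin k)).toEquiv]
    simp
  rw [← Nat.card_eq_fintype_card, Projectivization.card'', hc, qNumber,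
    Nat.card_eq_fintype_card]

/-! ### Adding and removing simplex copies; the bijection on classes. -/

section Shift

variable {F : Type*} [Field F] [Fintype F] [DecidableEq F] {k : ℕ}
  [Fintype (ℙ F (Dual F (Fin k → F)))]

theorem isLCDMult_add_const_iff (hk : 2 < (Fintype.card F - 1) * k)
    (hu : ∀ c : Fˣ, (c : F) * c = 1) (m : ℙ F (Dual F (Fin k → F)) → ℕ) (d e : ℕ) :
    IsLCDMult (m + fun _ => e) (d + Fintype.card F ^ (k - 1) * e) ↔ IsLCDMult m d := by
  have hk1 : 1 ≤ k := Nat.one_le_iff_ne_zero.2 (by rintro rfl; simp at hk)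
  have hw : ∀ x, x ≠ 0 → wt (m + fun _ => e) x = wt m x + Fintype.card F ^ (k - 1) * e := by
    intro x hx
    rw [wt_add, wt_const, wt_one hk1 x hx, mul_comm]
  have hg : gram (m + fun _ => e) = gram m := by
    rw [gram_add, gram_const, gram_one hk hu, smul_zero, add_zero]
  unfold IsLCDMult
  rw [hg]
  refine and_congr (forall₂_congr fun x hx => ?_) (and_congr_left' (exists_congr fun x =>
    and_congr_right fun hx => ?_))
  · rw [hw x hx, Nat.add_le_add_iff_right]
  · rw [hw x hx, Nat.add_right_cancel_iff]

end Shift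

theorem nonempty_quotient_equiv {A B : Type*} (sA : Setoid A) (sB : Setoid B) (R : A → B → Prop)
    (h₁ : ∀ a, ∃ b, R a b) (h₂ : ∀ b, ∃ a, R a b)
    (h : ∀ a a' b b', R a b → R a' b' → (sA a a' ↔ sB b b')) :
    Nonempty (Quotient sA ≃ Quotient sB) := by
  choose f hf using h₁
  let φ : Quotient sA → Quotient sB :=
    Quotient.map f fun a a' haa => (h a a' _ _ (hf a) (hf a')).1 haa
  refine ⟨Equiv.ofBijective φ ⟨?_, ?_⟩⟩
  · intro x y
    refine Quotient.inductionOn₂ x y fun a a' hxy => ?_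
    exact Quotient.sound ((h a a' _ _ (hf a) (hf a')).2 (Quotient.exact hxy))
  · intro y
    refine Quotient.inductionOn y fun b => ?_
    obtain ⟨a, ha⟩ := h₂ b
    exact ⟨Quotient.mk sA a, Quotient.sound ((h a a _ _ (hf a) ha).1 (sA.refl a))⟩

/-- Two codes correspond when they have generator columns whose multiplicities differ by the
constant `e`. The hypothesis `he` combines with `le_mult_of_le_wt` to make every multiplicity of the
longer code at least `e`, so subtraction is possible. -/
theorem nonempty_LCDClasses_equiv {F : Type*} [Field F] [Fintype F] [DecidableEq F]
    {k n n' d d' e : ℕ} (hk : 2 < (Fintype.card F - 1) * k) (hu : ∀ c : Fˣ, (c : F) * c = 1)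
    (hn : n' = n + qNumber (Fintype.card F) k * e) (hd : d' = d + Fintype.card F ^ (k - 1) * e)
    (hd0 : 0 < d) (he : e + (Fintype.card F - 1) * n' ≤ Fintype.card F * d') :
    Nonempty (LCDClasses F n k d ≃ LCDClasses F n' k d') := by
  classical
  have : Finite (Dual F (Fin k → F)) := Finite.of_equiv _ (dotProductEquiv F (Fin k)).toEquiv
  have := Fintype.ofFinite (ℙ F (Dual F (Fin k → F)))
  have hsum : ∑ _P : ℙ F (Dual F (Fin k → F)), e = qNumber (Fintype.card F) k * e := by
    rw [Finset.sum_const, Finset.card_univ, card_projectivization_dual, smul_eq_mul]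
  refine nonempty_quotient_equiv _ _ (fun C C' => ∃ (g : Fin n → Dual F (Fin k → F))
    (h : Fin n' → Dual F (Fin k → F)), Function.Injective (LinearMap.pi g) ∧
    Function.Injective (LinearMap.pi h) ∧ codeOf g = C.1 ∧ codeOf h = C'.1 ∧
    (mult h : ℙ F (Dual F (Fin k → F)) → ℕ) = mult g + fun _ => e) ?_ ?_ ?_
  · rintro ⟨C, hC, hCp, hCd⟩
    obtain ⟨g, hg, rfl⟩ := exists_codeOf_eq C hCp.1
    have hg0 := (two_le_minWeight_dualCode_iff g).1 hCd
    have hgood := isLCDMult_mult hu g hg d hC hCp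
    obtain ⟨h, hh0, hh⟩ := exists_family (F := F) (W := Dual F (Fin k → F))
      (mult g + fun _ => e) (n := n') (by
        simp only [Pi.add_apply, Finset.sum_add_distrib]
        rw [hsum, sum_mult_of_ne_zero g hg0, Fintype.card_fin, hn])
    have hgood' : IsLCDMult (mult h) d' := by
      rw [hh, hd, isLCDMult_add_const_iff hk hu]
      exact hgood
    obtain ⟨i1, i2, i3⟩ := hgood'.codeOf hu h d' (by omega)
    exact ⟨⟨codeOf h, i2, i3, (two_le_minWeight_dualCode_iff h).2 hh0⟩, g, h, hg, i1, rfl, rfl, hh⟩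
  · rintro ⟨C, hC, hCp, hCd⟩
    obtain ⟨h, hh, rfl⟩ := exists_codeOf_eq C hCp.1
    have hh0 := (two_le_minWeight_dualCode_iff h).1 hCd
    have hgood := isLCDMult_mult hu h hh d' hC hCp
    have hsumh := sum_mult_of_ne_zero (F := F) h hh0
    rw [Fintype.card_fin] at hsumh
    have hle : ∀ P : ℙ F (Dual F (Fin k → F)), e ≤ mult h P := by
      intro P
      have := le_mult_of_le_wt (mult h) d' hgood.1 P
      rw [hsumh] at this
      omega
    have hm : (mult h : ℙ F (Dual F (Fin k → F)) → ℕ) =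
        (fun P => mult h P - e) + fun _ => e := by
      funext P
      have := hle P
      simp only [Pi.add_apply]
      omega
    obtain ⟨g, hg0, hg⟩ := exists_family (F := F) (W := Dual F (Fin k → F))
      (fun P => mult h P - e) (n := n) (by
        rw [hm] at hsumh
        simp only [Pi.add_apply, Finset.sum_add_distrib] at hsumh
        rw [hsum] at hsumh
        omega)
    rw [← hg] at hm
    have hgood' : IsLCDMult (mult g) d := by
      rw [hm, hd, isLCDMult_add_const_iff hk hu] at hgood
      exact hgood
    obtain ⟨i1, i2, i3⟩ := hgood'.codeOf hu g d hd0
    exact ⟨⟨codeOf g, i2, i3, (two_le_minWeight_dualCode_iff g).2 hg0⟩, g, h, i1, hh, rfl, rfl, hm⟩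
  · rintro ⟨C₁, -, -, h1⟩ ⟨C₂, -, -, h2⟩ ⟨D₁, -, -, h3⟩ ⟨D₂, -, -, h4⟩
      ⟨g, h, hg, hh, rfl, rfl, hm⟩ ⟨g', h', hg', hh', rfl, rfl, hm'⟩
    rw [two_le_minWeight_dualCode_iff] at h1 h2 h3 h4
    change CodeEquiv (codeOf g) (codeOf g') ↔ CodeEquiv (codeOf h) (codeOf h')
    rw [codeEquiv_codeOf_iff g g' hg hg' h1 h2, codeEquiv_codeOf_iff h h' hh hh' h3 h4]
    refine exists_congr fun A => ?_
    have hsurj : ∀ P : ℙ F (Dual F (Fin k → F)), ∃ Q : ℙ F (Dual F (Fin k → F)),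
        Q.map A.toLinearMap A.injective = P := by
      intro P
      induction P using Projectivization.ind with
      | h v hv =>
        refine ⟨Projectivization.mk F (A.symm v) (by simpa using hv), ?_⟩
        simp [Projectivization.map_mk]
    -- `A` permutes the projective points, so the constant summand is unaffected and cancels.
    have key : (mult (fun i => A (h i)) : ℙ F (Dual F (Fin k → F)) → ℕ) =
        mult (fun i => A (g i)) + fun _ => e := by
      funext P
      obtain ⟨Q, rfl⟩ := hsurj P
      rw [Pi.add_apply, mult_comp_equiv, mult_comp_equiv, hm, Pi.add_apply]
    rw [key, hm', add_left_inj]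

/-! ### Filling zero columns without losing LCD or the minimum weight. -/

section AddColumns

variable {F : Type*} [Field F] [DecidableEq F] {k : ℕ}
  [Fintype (ℙ F (Dual F (Fin k → F)))]

omit [DecidableEq F] in
theorem gram_comm (m : ℙ F (Dual F (Fin k → F)) → ℕ) (x y : Fin k → F) :
    gram m x y = gram m y x := by
  simp [gram, mul_comm]

theorem wt_single_mk [DecidableEq (ℙ F (Dual F (Fin k → F)))] (φ : Dual F (Fin k → F))
    (hφ : φ ≠ 0) (z : ℕ) (x : Fin k → F) :
    wt (Pi.single (Projectivization.mk F φ hφ) z) x = z * if φ x ≠ 0 then 1 else 0 := by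
  obtain ⟨a, ha⟩ := Projectivization.exists_smul_eq_mk_rep F φ hφ
  rw [wt_single, ← ha]
  simp [Units.smul_def]

omit [DecidableEq F] in
theorem gram_single_mk [DecidableEq (ℙ F (Dual F (Fin k → F)))]
    (hu : ∀ c : Fˣ, (c : F) * c = 1) (φ : Dual F (Fin k → F))
    (hφ : φ ≠ 0) (z : ℕ) (x y : Fin k → F) :
    gram (Pi.single (Projectivization.mk F φ hφ) z) x y = z * (φ x * φ y) := by
  obtain ⟨a, ha⟩ := Projectivization.exists_smul_eq_mk_rep F φ hφ
  rw [gram_single, ← ha]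
  simp only [Units.smul_def, LinearMap.smul_apply, LinearMap.smulRight_apply, smul_eq_mul]
  rw [mul_mul_mul_comm, hu, one_mul]

/-- Add `z` copies of one functional `φ`. If `φ` vanishes at a word of minimum weight, `d` is kept;
the rank-one update of the Gram form `G` stays nondegenerate if `1 + z φ(G⁻¹ φ) ≠ 0`. For `k ≥ 3`
the functionals vanishing at the word have dimension at least 2, enough room for both. -/
theorem IsLCDMult.exists_add_columns (hk : 3 ≤ k) (hu : ∀ c : Fˣ, (c : F) * c = 1)
    {m : ℙ F (Dual F (Fin k → F)) → ℕ} {d : ℕ} (h : IsLCDMult m d) (z : ℕ) :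
    ∃ m' : ℙ F (Dual F (Fin k → F)) → ℕ, IsLCDMult m' d ∧ ∑ P, m' P = ∑ P, m P + z := by
  classical
  obtain ⟨h1, ⟨x₀, hx₀, hw⟩, h3⟩ := h
  have hinj : Function.Injective (gram m) := by
    rw [← LinearMap.ker_eq_bot, LinearMap.ker_eq_bot']
    exact h3
  let e : (Fin k → F) ≃ₗ[F] Dual F (Fin k → F) :=
    LinearEquiv.ofInjectiveOfFinrankEq (gram m) hinj (by rw [Subspace.dual_finrank_eq])
  have he : ∀ φ, gram m (e.symm φ) = φ := fun φ => e.apply_symm_apply φ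
  obtain ⟨φ, hφ, hφx, hQ⟩ : ∃ φ : Dual F (Fin k → F), φ ≠ 0 ∧ φ x₀ = 0 ∧
      1 + z * φ (e.symm φ) ≠ 0 := by
    by_contra hno
    push Not at hno
    let H := LinearMap.ker (Dual.eval F (Fin k → F) x₀)
    have hH : 1 < finrank F H := by
      have h4 := LinearMap.finrank_range_add_finrank_ker (Dual.eval F (Fin k → F) x₀)
      have h5 := Submodule.finrank_le (LinearMap.range (Dual.eval F (Fin k → F) x₀))
      rw [Subspace.dual_finrank_eq, finrank_fin_fun] at h4
      rw [finrank_self] at h5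
      change 1 < finrank F (LinearMap.ker (Dual.eval F (Fin k → F) x₀))
      omega
    have : Nontrivial H := Module.nontrivial_of_finrank_pos (R := F) (by omega)
    obtain ⟨u, hu0⟩ := exists_ne (0 : H)
    obtain ⟨w, hli⟩ := exists_linearIndependent_pair_of_one_lt_finrank (R := F) (M := H) hH hu0
    have hne : ∀ a b : F, a ≠ 0 → a • (u : Dual F (Fin k → F)) + b • (w : Dual F (Fin k → F)) ≠ 0 := by
      intro a b ha h0
      refine ha ((LinearIndependent.pair_iff.1 hli a b ?_).1)
      exact Subtype.ext (by simpa using h0)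
    have hux : (u : Dual F (Fin k → F)) x₀ = 0 := u.2
    have hwx : (w : Dual F (Fin k → F)) x₀ = 0 := w.2
    have hw0 : (w : Dual F (Fin k → F)) ≠ 0 := by
      intro h0
      exact one_ne_zero ((LinearIndependent.pair_iff.1 hli 0 1 (by
        exact Subtype.ext (by simpa using h0))).2)
    have hsymm : (w : Dual F (Fin k → F)) (e.symm u) = (u : Dual F (Fin k → F)) (e.symm w) := by
      conv_lhs => rw [← he w]
      conv_rhs => rw [← he u]
      exact gram_comm _ _ _
    have e1 := hno u (by simpa using hu0) hux
    have e2 := hno w hw0 hwx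
    have e3 := hno (u + w) (by simpa using hne 1 1 one_ne_zero) (by simp [hux, hwx])
    have e4 := hno (u - w) (fun h0 =>
      hne 1 (-1) one_ne_zero (LinearMap.ext fun x => by
        simpa [sub_eq_add_neg] using LinearMap.congr_fun h0 x))
      (by simp [hux, hwx])
    simp only [map_add, map_sub, LinearMap.add_apply, LinearMap.sub_apply, hsymm] at e3 e4
    -- The parallelogram law for `φ ↦ φ(G⁻¹ φ)` on `u`, `w`, `u + w`, `u - w`. In the remaining case
    -- of characteristic 2 that form is additive, so `u`, `w` and `u + w` already conflict.
    have h2 : (2 : F) = 0 := by linear_combination 2 * e1 + 2 * e2 - e3 - e4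
    exact one_ne_zero (α := F) (by
      linear_combination e1 + e2 - e3 + (z * (u : Dual F (Fin k → F)) (e.symm w)) * h2)
  refine ⟨m + Pi.single (Projectivization.mk F φ hφ) z, ⟨?_, ⟨x₀, hx₀, ?_⟩, ?_⟩, ?_⟩
  · intro x hx
    rw [wt_add]
    exact (h1 x hx).trans (Nat.le_add_right _ _)
  · rw [wt_add, wt_single_mk, hφx, hw]
    simp
  · intro x hx
    have hy : ∀ y, gram m x y + z * (φ x * φ y) = 0 := fun y => by
      rw [← gram_single_mk hu φ hφ z x y, ← LinearMap.add_apply, ← LinearMap.add_apply, ← gram_add,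
        hx, LinearMap.zero_apply]
    have h4 := hy (e.symm φ)
    rw [gram_comm, he] at h4
    have h5 : φ x * (1 + z * φ (e.symm φ)) = 0 := by linear_combination h4
    have h6 := (mul_eq_zero.1 h5).resolve_right hQ
    refine h3 x (LinearMap.ext fun y => ?_)
    have := hy y
    rw [h6, zero_mul, mul_zero, add_zero] at this
    exact this
  · simp [Finset.sum_add_distrib]

end AddColumns

/-- Each nonzero `x` is killed by exactly one of the four points, so its weight is `3r` minus that
multiplicity. It remains to choose multiplicities with sum `3r` and maximum `r` whose Gram matrix is
invertible mod 3. -/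
theorem exists_isLCDMult_ternary_two {F : Type*} [Field F] [Fintype F] [DecidableEq F]
    [Fintype (ℙ F (Dual F (Fin 2 → F)))] (hF : Fintype.card F = 3)
    (hu : ∀ c : Fˣ, (c : F) * c = 1) (r : ℕ) (hr : 2 ≤ r) :
    ∃ m : ℙ F (Dual F (Fin 2 → F)) → ℕ, IsLCDMult m (2 * r) ∧ ∑ P, m P = 3 * r := by
  classical
  have h3 : (3 : F) = 0 := by
    have := FiniteField.cast_card_eq_zero F
    rw [hF] at this
    exact_mod_cast this
  have h2 : (2 : F) ≠ 0 := fun h2 => one_ne_zero (α := F) (by linear_combination h3 - h2)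
  let p₀ : Dual F (Fin 2 → F) := LinearMap.proj 0
  let p₁ : Dual F (Fin 2 → F) := LinearMap.proj 1
  have ha : p₀ ≠ 0 := fun h => by simpa [p₀] using LinearMap.congr_fun h ![1, 0]
  have hb : p₁ ≠ 0 := fun h => by simpa [p₁] using LinearMap.congr_fun h ![0, 1]
  have hc : p₀ + p₁ ≠ 0 := fun h => by simpa [p₀, p₁] using LinearMap.congr_fun h ![1, 0]
  have hd : p₀ - p₁ ≠ 0 := fun h => by simpa [p₀, p₁] using LinearMap.congr_fun h ![1, 0]
  let M : ℕ → ℕ → ℕ → ℕ → ℙ F (Dual F (Fin 2 → F)) → ℕ := fun a b c d =>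
    Pi.single (Projectivization.mk F _ ha) a + Pi.single (Projectivization.mk F _ hb) b +
      Pi.single (Projectivization.mk F _ hc) c + Pi.single (Projectivization.mk F _ hd) d
  have hwt : ∀ a b c d x, wt (M a b c d) x = (a * if x 0 ≠ 0 then 1 else 0) +
      (b * if x 1 ≠ 0 then 1 else 0) + (c * if x 0 + x 1 ≠ 0 then 1 else 0) +
      (d * if x 0 - x 1 ≠ 0 then 1 else 0) := by
    intro a b c d x
    simp only [M, wt_add, wt_single_mk]
    rfl
  have hgram : ∀ a b c d x, gram (M a b c d) x = 0 → ∀ y : Fin 2 → F,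
      a * (x 0 * y 0) + b * (x 1 * y 1) + c * ((x 0 + x 1) * (y 0 + y 1)) +
        d * ((x 0 - x 1) * (y 0 - y 1)) = 0 := by
    intro a b c d x hx y
    have := LinearMap.congr_fun hx y
    simp only [M, gram_add, LinearMap.add_apply, gram_single_mk hu] at this
    exact this
  have hsum : ∀ a b c d, ∑ P, M a b c d P = a + b + c + d := by
    intro a b c d
    simp [M, Finset.sum_add_distrib]
  have htri : ∀ x : Fin 2 → F, x ≠ 0 → (x 0 = 0 ∧ x 1 ≠ 0) ∨ (x 0 ≠ 0 ∧ x 1 = 0) ∨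
      (x 0 ≠ 0 ∧ x 1 ≠ 0 ∧ x 0 + x 1 = 0 ∧ x 0 - x 1 ≠ 0) ∨
      (x 0 ≠ 0 ∧ x 1 ≠ 0 ∧ x 0 + x 1 ≠ 0 ∧ x 0 - x 1 = 0) := by
    intro x hx
    by_cases h0 : x 0 = 0
    · refine Or.inl ⟨h0, fun h1 => hx ?_⟩
      funext i
      fin_cases i
      · exact h0
      · exact h1
    · by_cases h1 : x 1 = 0
      · exact Or.inr (Or.inl ⟨h0, h1⟩)
      · have h4 : (x 0 + x 1) * (x 0 - x 1) = 0 := by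
          have e0 := hu (Units.mk0 _ h0)
          have e1 := hu (Units.mk0 _ h1)
          simp only [Units.val_mk0] at e0 e1
          linear_combination e0 - e1
        have h5 : ¬ (x 0 + x 1 = 0 ∧ x 0 - x 1 = 0) := by
          rintro ⟨h5, h6⟩
          exact mul_ne_zero h2 h0 (by linear_combination h5 + h6)
        rcases mul_eq_zero.1 h4 with h | h
        · exact Or.inr (Or.inr (Or.inl ⟨h0, h1, h, fun h' => h5 ⟨h, h'⟩⟩))
        · exact Or.inr (Or.inr (Or.inr ⟨h0, h1, fun h' => h5 ⟨h', h⟩, h⟩))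
  have hex : (![0, 1] : Fin 2 → F) ≠ 0 := fun h => by simpa using congrFun h 1
  obtain ⟨s, rfl⟩ := Nat.exists_eq_add_of_le' hr
  by_cases hr3 : ((s + 2 : ℕ) : F) = 0
  · refine ⟨M (s + 2) (s + 2) (s + 1) 1, ⟨fun x hx => ?_, ⟨![0, 1], hex, ?_⟩, fun x hx => ?_⟩, ?_⟩
    · rw [hwt]
      rcases htri x hx with ⟨h, h'⟩ | ⟨h, h'⟩ | ⟨h, h', h'', h'''⟩ | ⟨h, h', h'', h'''⟩ <;>
        simp [*] <;> omega
    · rw [hwt]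
      simp
      omega
    · have g0 := hgram _ _ _ _ x hx ![1, 0]
      have g1 := hgram _ _ _ _ x hx ![0, 1]
      simp at g0 g1
      push_cast at hr3
      funext i
      fin_cases i
      · refine (mul_eq_zero.1 (?_ : 2 * x 0 = 0)).resolve_left h2
        linear_combination (-1 : F) * g1 + (x 0 + 2 * x 1) * hr3
      · refine (mul_eq_zero.1 (?_ : 2 * x 1 = 0)).resolve_left h2
        linear_combination (-1 : F) * g0 + (2 * x 0 + x 1) * hr3
    · rw [hsum]
      omega
  -- Here the diagonal is `2r + 1`, `2r` and the off-diagonal entry is `r` mod 3, so the determinant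
  -- is `2r ≠ 0`.
  · refine ⟨M (s + 2) (s + 1) (s + 1) 2, ⟨fun x hx => ?_, ⟨![0, 1], hex, ?_⟩, fun x hx => ?_⟩, ?_⟩
    · rw [hwt]
      rcases htri x hx with ⟨h, h'⟩ | ⟨h, h'⟩ | ⟨h, h', h'', h'''⟩ | ⟨h, h', h'', h'''⟩ <;>
        simp [*] <;> omega
    · rw [hwt]
      simp
      omega
    · have g0 := hgram _ _ _ _ x hx ![1, 0]
      have g1 := hgram _ _ _ _ x hx ![0, 1]
      simp at g0 g1
      push_cast at hr3
      have e01 : x 0 = x 1 := by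
        refine sub_eq_zero.1 ((mul_eq_zero.1 (?_ : ((s : F) + 2) * (x 0 - x 1) = 0)).resolve_left hr3)
        linear_combination g1 + (x 0 - ((s : F) + 2) * x 1) * h3
      have e1 : x 1 = 0 := by
        rw [e01] at g0
        linear_combination g0 - ((s : F) + 1) * x 1 * h3
      funext i
      fin_cases i
      · exact e01.trans e1
      · exact e1
    · rw [hsum]
      omega

/-- With `z` zero columns only `n - z` columns count, so the multiplicity bound improves to `e +
(q-1) z`. After shifting by `e` every point keeps multiplicity at least `(q-1) z`. -/
theorem exists_full_support {F : Type*} [Field F] [Fintype F] [DecidableEq F] {q k n d r : ℕ}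
    {e : ℤ} (hF : Fintype.card F = q) (hqk : 3 ≤ k ∨ q = 3 ∧ k = 2)
    (hk : 2 < (q - 1) * k) (hu : ∀ c : Fˣ, (c : F) * c = 1)
    (hn : (n : ℤ) = q * r + qNumber q k * e) (hd : (d : ℤ) = (q - 1 : ℕ) * r + (q ^ (k - 1) : ℕ) * e)
    (hr : 0 < r) (he : e + (q - 1 : ℕ) * n = q * d) (C : Submodule F (Fin n → F)) (hC : IsLCD C)
    (hCp : HasParams C k d) :
    ∃ C' : Submodule F (Fin (q * r) → F), IsLCD C' ∧ HasParams C' k ((q - 1) * r : ℕ) ∧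
      2 ≤ minWeight (dualCode C') := by
  classical
  have : Finite (Dual F (Fin k → F)) := Finite.of_equiv _ (dotProductEquiv F (Fin k)).toEquiv
  have := Fintype.ofFinite (ℙ F (Dual F (Fin k → F)))
  have hq : 1 < q := hF ▸ Fintype.one_lt_card
  have hsum : ∀ c : ℕ, ∑ _P : ℙ F (Dual F (Fin k → F)), c = qNumber q k * c := fun c => by
    rw [Finset.sum_const, Finset.card_univ, card_projectivization_dual, smul_eq_mul, hF]
  obtain ⟨g, hg, rfl⟩ := exists_codeOf_eq C hCp.1
  have hgood := isLCDMult_mult hu g hg d hC hCp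
  obtain ⟨z, hz⟩ : ∃ z, ∑ P : ℙ F (Dual F (Fin k → F)), mult g P + z = n := by
    refine ⟨n - ∑ P : ℙ F (Dual F (Fin k → F)), mult g P, Nat.add_sub_cancel' ?_⟩
    rw [sum_mult]
    simpa using Finset.card_filter_le (Finset.univ : Finset (Fin n)) (fun i => g i ≠ 0)
  have hle : ∀ P : ℙ F (Dual F (Fin k → F)), e + (q - 1 : ℕ) * z ≤ mult g P := by
    intro P
    have h1 := le_mult_of_le_wt (mult g) d hgood.1 P
    rw [hF] at h1
    have h2 : (q : ℤ) * d ≤ mult g P + (q - 1 : ℕ) * (n - z) := by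
      have h3 : ((∑ P : ℙ F (Dual F (Fin k → F)), mult g P : ℕ) : ℤ) = n - z := by
        rw [eq_sub_iff_add_eq]
        exact_mod_cast hz
      rw [← h3]
      exact_mod_cast h1
    linarith
  obtain ⟨m, hm, hmsum, hmz⟩ : ∃ m : ℙ F (Dual F (Fin k → F)) → ℕ,
      IsLCDMult m ((q - 1) * r) ∧ ∑ P, m P + z = q * r ∧ ∀ P, (q - 1) * z ≤ m P := by
    -- For `e ≥ 0` simplex copies are removed; for `e ≤ 0` they are added.
    obtain ⟨a, rfl | rfl⟩ := e.eq_nat_or_neg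
    · have hm : (mult g : ℙ F (Dual F (Fin k → F)) → ℕ) =
          (fun P => mult g P - a) + fun _ => a := by
        funext P
        have : a ≤ mult g P := by
          zify
          exact le_trans (le_add_of_nonneg_right (by positivity)) (hle P)
        simp only [Pi.add_apply]
        omega
      refine ⟨fun P => mult g P - a, ?_, ?_, ?_⟩
      · rw [← isLCDMult_add_const_iff (hF ▸ hk) hu _ _ a, ← hm, hF]
        convert hgood using 1
        zify
        rw [hd]
        push_cast
        rfl
      · have h4 := congrArg (fun f : ℙ F (Dual F (Fin k → F)) → ℕ => ∑ P, f P) hm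
        simp only [Pi.add_apply, Finset.sum_add_distrib] at h4
        rw [hsum] at h4
        zify at hz h4 ⊢
        linarith
      · intro P
        have := hle P
        have h5 : a + (q - 1) * z ≤ mult g P := by exact_mod_cast this
        exact Nat.le_sub_of_add_le' h5
    · refine ⟨mult g + fun _ => a, ?_, ?_, ?_⟩
      · have : (q - 1) * r = d + Fintype.card F ^ (k - 1) * a := by
          rw [hF]
          zify
          push_cast at hd ⊢
          linarith
        rw [this, isLCDMult_add_const_iff (hF ▸ hk) hu]
        exact hgood
      · simp only [Pi.add_apply, Finset.sum_add_distrib]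
        rw [hsum]
        zify at hz ⊢
        linarith
      · intro P
        have := hle P
        zify
        simp only [Pi.add_apply]
        push_cast at this ⊢
        linarith
  obtain ⟨m', hm', hmsum'⟩ : ∃ m' : ℙ F (Dual F (Fin k → F)) → ℕ,
      IsLCDMult m' ((q - 1) * r) ∧ ∑ P, m' P = q * r := by
    rcases hqk with hk3 | ⟨rfl, rfl⟩
    · obtain ⟨m', h1, h2⟩ := hm.exists_add_columns hk3 hu z
      exact ⟨m', h1, h2.trans hmsum⟩
    · rcases Nat.eq_zero_or_pos z with rfl | hzpos
      · exact ⟨m, hm, hmsum⟩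
      · refine exists_isLCDMult_ternary_two hF hu r ?_
        -- Four points of multiplicity at least `2z` give `8z ≤ 3r - z`, hence `r ≥ 3z`.
        have h6 : ∑ _P : ℙ F (Dual F (Fin 2 → F)), (3 - 1) * z ≤ ∑ P, m P :=
          Finset.sum_le_sum fun P _ => hmz P
        rw [hsum, show qNumber 3 2 = 4 from rfl] at h6
        omega
  obtain ⟨h, hh0, hh⟩ := exists_family (F := F) (W := Dual F (Fin k → F)) m' hmsum'
  rw [← hh] at hm'
  obtain ⟨-, i2, i3⟩ := hm'.codeOf hu h _ (Nat.mul_pos (by omega) hr)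
  exact ⟨codeOf h, i2, i3, (two_le_minWeight_dualCode_iff h).2 hh0⟩

end LCDCode

/-! ### Parameter arithmetic and conclusion. -/

theorem mainTheorem2 {F : Type*} [Field F] [Fintype F] [DecidableEq F]
    (q k₀ k t : ℕ) (hF : Fintype.card F = q)
    (hq : (q, k₀) = (2, 3) ∨ (q, k₀) = (3, 2)) (hk : k₀ ≤ k)
    (ht : t < LCDCode.qNumber q k) (α : ℕ → ℤ) :
    ∃ r s' : ℤ,
      (∀ s : ℕ, LCDCode.rParam q (LCDCode.qNumber q k * s + t) k
        ((q : ℤ) ^ (k - 1) * s + α t) = r) ∧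
      (∀ s : ℕ, LCDCode.sParam q (LCDCode.qNumber q k * s + t) k
        ((q : ℤ) ^ (k - 1) * s + α t) = s') ∧
      ((k : ℤ) ≤ q * r →
        (q * r = LCDCode.qNumber q k * (s' - 1) + t ∧
          ((q : ℤ) - 1) * r = (q : ℤ) ^ (k - 1) * (s' - 1) + α t) ∧
        (∀ s : ℕ, s' ≤ s →
          Nonempty (LCDCode.LCDClasses F (q * r).toNat k (((q : ℤ) - 1) * r) ≃
            LCDCode.LCDClasses F (LCDCode.qNumber q k * s + t) k
              ((q : ℤ) ^ (k - 1) * s + α t))) ∧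
        ((¬ ∃ C : Submodule F (Fin (q * r).toNat → F), LCDCode.IsLCD C ∧
            LCDCode.HasParams C k (((q : ℤ) - 1) * r) ∧
            2 ≤ LCDCode.minWeight (LCDCode.dualCode C)) →
          ∀ s : ℕ, ¬ ∃ C : Submodule F (Fin (LCDCode.qNumber q k * s + t) → F),
            LCDCode.IsLCD C ∧
            LCDCode.HasParams C k ((q : ℤ) ^ (k - 1) * s + α t))) := by
  have hq1 : 1 < q := hF ▸ Fintype.one_lt_card
  have hqk : 3 ≤ k ∨ q = 3 ∧ k = 2 := by
    simp only [Prod.mk.injEq] at hq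
    omega
  have hk2 : 2 < (q - 1) * k := by
    simp only [Prod.mk.injEq] at hq
    rcases hq with ⟨rfl, rfl⟩ | ⟨rfl, rfl⟩ <;> omega
  have hu : ∀ c : Fˣ, (c : F) * c = 1 := by
    intro c
    have h1 := FiniteField.pow_card_sub_one_eq_one (c : F) c.ne_zero
    simp only [Prod.mk.injEq] at hq
    rcases hq with ⟨rfl, rfl⟩ | ⟨rfl, rfl⟩
    · rw [hF] at h1
      have h2 : (c : F) = 1 := by simpa using h1
      rw [h2, one_mul]
    · rw [hF] at h1
      simpa [pow_two] using h1
  -- The parameter identities below all rest on this relation between `[k]_q` and `q^(k-1)`.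
  have hK : (LCDCode.qNumber q k : ℤ) * (q - 1) = q * q ^ (k - 1) - 1 := by
    have h1 : LCDCode.qNumber q k * (q - 1) = q ^ k - 1 :=
      Nat.div_mul_cancel (by simpa using Nat.sub_dvd_pow_sub_pow q 1 k)
    have h2 : 1 ≤ q ^ k := Nat.one_le_pow _ _ (by omega)
    zify [h2, hq1.le] at h1
    rw [h1, ← pow_succ', Nat.sub_add_cancel (by omega)]
  have hKpos : 0 < LCDCode.qNumber q k := by omega
  generalize hKdef : LCDCode.qNumber q k = K at *
  obtain ⟨Q, hQ⟩ : ∃ Q : ℕ, Q = q ^ (k - 1) := ⟨_, rfl⟩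
  have hQz : (q : ℤ) ^ (k - 1) = Q := by rw [hQ]; push_cast; rfl
  simp only [hQz] at hK ⊢
  have hrP : ∀ s : ℕ, LCDCode.rParam q (K * s + t) k (Q * s + α t) = Q * t - K * α t := by
    intro s
    rw [LCDCode.rParam, hKdef, hQz]
    push_cast
    ring
  have hqr : (q : ℤ) * (Q * t - K * α t) = K * ((q - 1) * t - q * α t) + t := by
    linear_combination (-(t : ℤ)) * hK
  have hqr' : ((q : ℤ) - 1) * (Q * t - K * α t) = Q * ((q - 1) * t - q * α t) + α t := by
    linear_combination (-α t) * hK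
  refine ⟨Q * t - K * α t, ((q - 1) * t - q * α t) + 1, hrP, fun s => ?_, fun hkr => ?_⟩
  · rw [LCDCode.sParam, hrP, hKdef, Nat.mul_add_mod, Nat.mod_eq_of_lt ht, hqr, add_sub_cancel_right,
      Int.mul_ediv_cancel_left _ (by exact_mod_cast hKpos.ne')]
  rw [add_sub_cancel_right]
  refine ⟨⟨hqr, hqr'⟩, ?_⟩
  -- `q r ≥ k ≥ 1` forces `r > 0`, so that the minimum weight `(q-1) r` is positive.
  have hrpos : 0 < (Q : ℤ) * t - K * α t := by
    by_contra hneg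
    have : (q : ℤ) * (Q * t - K * α t) ≤ 0 :=
      mul_nonpos_of_nonneg_of_nonpos (by positivity) (not_lt.1 hneg)
    omega
  generalize (Q : ℤ) * t - K * α t = r at *
  lift r to ℕ using hrpos.le
  have hN : ((q : ℤ) * r).toNat = q * r := by exact_mod_cast Int.toNat_natCast (q * r)
  have hD : ((q : ℤ) - 1) * r = ((q - 1) * r : ℕ) := by
    push_cast [hq1.le]
    ring
  have hr0 : 0 < r := by exact_mod_cast hrpos
  -- `w` is `s' - 1`; the number of simplex copies is `s - w = q d(s) - (q-1) n(s)`, so the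
  -- multiplicity bound is met with equality.
  generalize hw : ((q : ℤ) - 1) * t - q * α t = w at *
  rw [hN]
  constructor
  · intro s hs
    obtain ⟨e, he⟩ := Int.eq_ofNat_of_zero_le (a := (s : ℤ) - w) (by omega)
    have hd : (Q : ℤ) * s + α t = ((q - 1) * r + Fintype.card F ^ (k - 1) * e : ℕ) := by
      rw [hF, ← hQ]
      push_cast
      rw [← he]
      push_cast [hq1.le]
      linear_combination -hqr'
    rw [hd, hD]
    refine LCDCode.nonempty_LCDClasses_equiv (e := e) (hF ▸ hk2) hu ?_ rfl
      (Nat.mul_pos (by omega) hr0) (le_of_eq ?_)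
    · rw [hF, hKdef]
      zify
      rw [hqr, ← he]
      ring
    · rw [← Int.natCast_inj, Nat.cast_mul (Fintype.card F), ← hd, hF, Nat.cast_add, ← he]
      push_cast [hq1.le]
      linear_combination hw + (s : ℤ) * hK
  · rintro hno s ⟨C, hC, hCp⟩
    obtain ⟨d, -, hd⟩ := hCp.2
    rw [← hd] at hCp
    rw [hD] at hno
    refine hno (LCDCode.exists_full_support (e := s - w) hF hqk hk2 hu ?_ ?_ hr0 ?_ C hC hCp)
    · rw [hKdef, hqr]
      push_cast
      ring
    · rw [hd, ← hQ]
      push_cast [hq1.le]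
      linear_combination -hqr'
    · rw [hd]
      push_cast [hq1.le]
      linear_combination hw + (s : ℤ) * hK
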